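/- Let $G=(V,E)$ be an infinite, connected (simple) graph of bounded degree, and let $\mathbb G=(\mathbb V,\mathbb E)$ be the graph with vertex set $\mathbb V=V\times\mathbb Z$ and edge set $$\mathbb E=\{\langle (u,n),(v,n)\rangle : \langle u,v\rangle\in E,\ n\in\mathbb Z\}\cup\{\langle (w,n),(w,n+1)\rangle : w\in V,\ n\in\mathbb Z\}.$$ Let $(G^{(r)})_{r\in\mathbb N}$, $G^{(r)}=(U^{(r)},E^{(r)})$, be finite connected (in particular non-empty) subgraphs of $G$, and put $$\mathbb E^{\mathrm{in}}=\bigcup_{r\in\mathbb N}\Bigl(\{\langle (u,n),(v,n)\rangle : \langle u,v\rangle\in E^{(r)},\ n\in\mathbb Z\}\cup\{\langle (w,n),(w,n+1)\rangle : w\in U^{(r)},\ n\in\mathbb Z\}\Bigr).$$ For $p,q\in[0,1]$ let $\mathbb P_{q,p}$ be the product measure on $\{0,1\}^{\mathbb E}$ (with the $\sigma$-algebra generated by the cylinder sets) under which the edges are independent, each edge of $\mathbb E^{\mathrm{in}}$ is open with probability $q$, and each edge of $\mathbb E\setminus\mathbb E^{\mathrm{in}}$ is open with probability $p$. For $v\in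 V$, let $\{(v,0)\leftrightarrow\infty\}$ be the event that infinitely many vertices of $\mathbb G$ can be reached from $(v,0)$ along paths of open edges, and let $$p_c(q)=\sup\{p\in[0,1] : \mathbb P_{q,p}((v,0)\leftrightarrow\infty)=0\}.$$ If $\sup_{r\in\mathbb N}|U^{(r)}|<\infty$ and $\operatorname{dist}_G(U^{(i)},U^{(j)})\ge 3$ for all $i\neq j$, where $\operatorname{dist}_G$ is the graph distance, then, for every $v\in V$, the function $q\mapsto p_c(q)$ is continuous on $(0,1)$. -/

import Mathlib

open MeasureTheory ProbabilityTheory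

open scoped unitInterval

namespace LadderPercolation

universe u

variable {V : Type u}

/-- The ladder graph `𝔾 = G × ℤ`: the Cartesian (box) product of `G` with the graph on `ℤ` whose
edges join consecutive integers. -/
noncomputable def ladderGraph (G : SimpleGraph V) : SimpleGraph (V × ℤ) :=
  SimpleGraph.boxProd G (SimpleGraph.hasse ℤ)

/-- The edges of `G × ℤ` are exactly the horizontal edges `⟨(u, n), (v, n)⟩`, `⟨u, v⟩ ∈ E`, and the
vertical edges `⟨(w, n), (w, n + 1)⟩`. -/
theorem mem_edgeSet_ladderGraph (G : SimpleGraph V) (e : Sym2 (V × ℤ)) :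
    e ∈ (ladderGraph G).edgeSet ↔
      (∃ (u v : V) (n : ℤ), G.Adj u v ∧ e = s((u, n), (v, n))) ∨
        ∃ (w : V) (n : ℤ), e = s((w, n), (w, n + 1)) := by
  induction e using Sym2.ind with
  | _ x y =>
    obtain ⟨a, m⟩ := x
    obtain ⟨b, k⟩ := y
    simp only [ladderGraph, SimpleGraph.mem_edgeSet, SimpleGraph.boxProd_adj,
      SimpleGraph.hasse_adj, Order.covBy_iff_add_one_eq]
    constructor
    · rintro (⟨h, rfl⟩ | ⟨rfl | rfl, rfl⟩)
      · exact Or.inl ⟨a, b, m, h, rfl⟩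
      · exact Or.inr ⟨a, m, rfl⟩
      · exact Or.inr ⟨a, k, Sym2.eq_swap⟩
    · rintro (⟨u, v, n, h, he⟩ | ⟨w, n, he⟩)
      · rcases Sym2.eq_iff.1 he with ⟨h1, h2⟩ | ⟨h1, h2⟩ <;> cases h1 <;> cases h2
        · exact Or.inl ⟨h, rfl⟩
        · exact Or.inl ⟨h.symm, rfl⟩
      · rcases Sym2.eq_iff.1 he with ⟨h1, h2⟩ | ⟨h1, h2⟩ <;> cases h1 <;> cases h2
        · exact Or.inr ⟨Or.inl rfl, rfl⟩
        · exact Or.inr ⟨Or.inr rfl, rfl⟩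

/-- A percolation configuration: every edge of `G × ℤ` is open (`true`) or closed (`false`). The
`σ`-algebra on this type is the product one, generated by the cylinder sets. -/
abbrev Config (G : SimpleGraph V) : Type u :=
  (ladderGraph G).edgeSet → Bool

/-- The edges of the infinite cylinder `H × ℤ` over a subgraph `H` of `G`: horizontal edges over the
edges of `H`, and vertical edges over the vertices of `H`. -/
def cylinderEdges {G : SimpleGraph V} (H : G.Subgraph) : Set (Sym2 (V × ℤ)) :=
  {e | ∃ (u v : V) (n : ℤ), H.Adj u v ∧ e = s((u, n), (v, n))} ∪
    {e | ∃ (w : V) (n : ℤ), w ∈ H.verts ∧ e = s((w, n), (w, n + 1))}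

open scoped Classical in
/-- The probability that an edge is open: `q` on the cylinders over the subgraphs `H r`, and `p` on
all other edges. -/
noncomputable def edgeProb {G : SimpleGraph V} (H : ℕ → G.Subgraph) (q p : I)
    (e : (ladderGraph G).edgeSet) : I :=
  if (e : Sym2 (V × ℤ)) ∈ ⋃ r, cylinderEdges (H r) then q else p

/-- The law `ℙ_{q,p}` of inhomogeneous bond percolation: the product over all edges of `G × ℤ` of
the Bernoulli laws with the parameters above. -/
noncomputable def percolationMeasure {G : SimpleGraph V} (H : ℕ → G.Subgraph) (q p : I) :
    Measure (Config G) :=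
  Measure.infinitePi fun e => bernoulliMeasure true false (edgeProb H q p e)

/-- The random subgraph of `G × ℤ` formed by the open edges. -/
def openGraph {G : SimpleGraph V} (ω : Config G) : SimpleGraph (V × ℤ) :=
  SimpleGraph.fromEdgeSet {e | ∃ h : e ∈ (ladderGraph G).edgeSet, ω ⟨e, h⟩ = true}

/-- The open cluster of `x`: the vertices that can be reached from `x` along open paths. -/
def cluster {G : SimpleGraph V} (ω : Config G) (x : V × ℤ) : Set (V × ℤ) :=
  {y | (openGraph ω).Reachable x y}

/-- The event that `x` percolates, that is, that its open cluster is infinite. -/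
def percolates (G : SimpleGraph V) (x : V × ℤ) : Set (Config G) :=
  {ω | (cluster ω x).Infinite}

/-- The critical curve
`p_c(q) = sup {p ∈ [0, 1] : ℙ_{q,p} ((v, 0) percolates) = 0}`. -/
noncomputable def criticalCurve {G : SimpleGraph V} (H : ℕ → G.Subgraph) (v : V) (q : I) : ℝ :=
  sSup {x : ℝ | ∃ p : I, (p : ℝ) = x ∧ percolationMeasure H q p (percolates G (v, 0)) = 0}

end LadderPercolation

/-! A small change of `q` is made up for by a small increase of `p`. Suppose `c ≤ p' - p`, that `q`
and `q'` lie in `[c, 1 - c]`, and that `|q - q'|` is small compared with a fixed power of `c`. Then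
absence of percolation at `(q', p')` forces absence at `(q, p)` (`exists_percolates_null_transfer`).
Exchanging the roles of `q` and `q'` bounds the change of the critical value in both directions.

The comparison is a coupling, block by block. The cylinders, thickened by their neighbours, are cut
into blocks of height `L`; distance 3 makes the blocks edge-disjoint, and the bounds on sizes and
degrees give at most `K` edges per block. Pointwise domination may fail on cylinder edges, but it
suffices that each connection inside a block between boundary vertices persists
(`mem_percolates_of_connectsAtMost`). The coupling by uniform variables violates this with
probability at most `K * |q - q'|`. With probability at least `c ^ K` it yields a pair `(x₀, y₀)`
such that `x₀` connects no two distinct boundary vertices and `y₀` connects all those of the block.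
Exchanging second coordinates between bad pairs and this pair repairs the coupling without changing
its marginals (`exists_coupling_of_measure_le`).

If `q' ≤ q`, a cylinder edge closed in `x₀` cannot be open in `y₀`, so `x₀` and `y₀` are chosen to
agree on the cylinder and to differ only outside it. The comb does this: injective heights keep the
ends of the columns apart within the cylinder, yet all of them get connected once the outside edges
are open (`lowConfig_connectsAtMost`, `connectsAtMost_highConfig`). -/

namespace LadderPercolation

/-! ### Couplings of Bernoulli product measures -/

/-- A coupling `ρ` of two laws on a finite space can be modified so as to live on a relation `R`,
when `x₀` is `R`-minimal, `y₀` is `R`-maximal and the mass off `R` is at most the mass of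
`(x₀, y₀)`: on the event where `R` fails, the second coordinate is exchanged with `y₀`. -/
theorem exists_coupling_of_measure_le {C : Type*} [Finite C] [MeasurableSpace C]
    [MeasurableSingletonClass C] (ρ : Measure (C × C)) [IsProbabilityMeasure ρ]
    (R : C → C → Prop) (x₀ y₀ : C) (hx : ∀ y, R x₀ y) (hy : ∀ x, R x y₀)
    (h : ρ {z | ¬ R z.1 z.2} ≤ ρ {(x₀, y₀)}) :
    ∃ π : Measure (C × C), IsProbabilityMeasure π ∧ π.map Prod.fst = ρ.map Prod.fst ∧
      π.map Prod.snd = ρ.map Prod.snd ∧ ∀ᵐ z ∂π, R z.1 z.2 := by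
  set B : Set (C × C) := {z | ¬ R z.1 z.2} with hB
  set S : Set (C × C) := Bᶜ \ {(x₀, y₀)} with hS
  have hBm : MeasurableSet B := .of_discrete
  have hdec : ρ = ρ.restrict S + ρ {(x₀, y₀)} • Measure.dirac (x₀, y₀) + ρ.restrict B := by
    conv_lhs => rw [← Measure.restrict_compl_add_restrict (μ := ρ) hBm]
    congr 1
    have : Bᶜ = S ∪ {(x₀, y₀)} := by
      ext z
      by_cases hz : z = (x₀, y₀)
      · subst hz; simp [hS, hB, hx]
      · simp [hS, hz]
    rw [this, Measure.restrict_union (by simp [hS]) (measurableSet_singleton _),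
      Measure.restrict_singleton]
  -- A bad pair `(x, y)` and an equal mass of `(x₀, y₀)` become `(x, y₀)` and `(x₀, y)`: both
  -- marginals are kept and both new pairs satisfy `R`.
  let π : Measure (C × C) := ρ.restrict S + (ρ {(x₀, y₀)} - ρ B) • Measure.dirac (x₀, y₀) +
    ((ρ.restrict B).map (fun z => (z.1, y₀)) + (ρ.restrict B).map (fun z => (x₀, z.2)))
  have hsplit : ρ {(x₀, y₀)} - ρ B + ρ B = ρ {(x₀, y₀)} := tsub_add_cancel_of_le h
  have hf : π.map Prod.fst = ρ.map Prod.fst := by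
    conv_rhs => rw [hdec]
    simp only [π]
    rw [Measure.map_add _ _ (by fun_prop), Measure.map_add _ _ (by fun_prop),
      Measure.map_add _ _ (by fun_prop), Measure.map_add _ _ (by fun_prop),
      Measure.map_add _ _ (by fun_prop),
      Measure.map_map (by fun_prop) (by fun_prop), Measure.map_map (by fun_prop) (by fun_prop),
      Measure.map_smul, Measure.map_smul, Measure.map_dirac]
    have h1 : (Prod.fst ∘ fun z : C × C => (x₀, z.2)) = fun _ => x₀ := rfl
    have h2 : (Prod.fst ∘ fun z : C × C => (z.1, y₀)) = Prod.fst := rfl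
    rw [h1, h2, Measure.map_const, Measure.restrict_apply_univ]
    conv_rhs => rw [← hsplit, add_smul]
    abel
  have hs : π.map Prod.snd = ρ.map Prod.snd := by
    conv_rhs => rw [hdec]
    simp only [π]
    rw [Measure.map_add _ _ (by fun_prop), Measure.map_add _ _ (by fun_prop),
      Measure.map_add _ _ (by fun_prop), Measure.map_add _ _ (by fun_prop),
      Measure.map_add _ _ (by fun_prop),
      Measure.map_map (by fun_prop) (by fun_prop), Measure.map_map (by fun_prop) (by fun_prop),
      Measure.map_smul, Measure.map_smul, Measure.map_dirac]
    have h1 : (Prod.snd ∘ fun z : C × C => (x₀, z.2)) = Prod.snd := rfl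
    have h2 : (Prod.snd ∘ fun z : C × C => (z.1, y₀)) = fun _ => y₀ := rfl
    rw [h1, h2, Measure.map_const, Measure.restrict_apply_univ]
    conv_rhs => rw [← hsplit, add_smul]
    abel
  refine ⟨π, ⟨?_⟩, hf, hs, ?_⟩
  · have := congrArg (fun m => m Set.univ) hf
    simpa [Measure.map_apply measurable_fst MeasurableSet.univ] using this
  · simp only [π, ae_add_measure_iff]
    refine ⟨⟨?_, ?_⟩, ?_, ?_⟩
    · rw [ae_restrict_iff' .of_discrete]
      exact .of_forall fun z hz => by simpa [hB] using hz.1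
    · exact Measure.ae_smul_measure (((ae_dirac_iff (p := fun z : C × C => R z.1 z.2) .of_discrete).2 (hx _))) _
    · rw [ae_map_iff (by fun_prop) .of_discrete]
      exact .of_forall fun z => hy _
    · rw [ae_map_iff (by fun_prop) .of_discrete]
      exact .of_forall fun z => hx _

theorem measurable_decide_lt (p : I) : Measurable fun t : I => decide (t < p) :=
  measurable_to_bool (by
    have : (fun t : I => decide (t < p)) ⁻¹' {true} = Set.Iio p := by ext; simp
    rw [this]; exact measurableSet_Iio)

theorem map_decide_lt (p : I) :
    (volume : Measure I).map (fun t => decide (t < p)) = bernoulliMeasure true false p := by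
  have : IsProbabilityMeasure ((volume : Measure I).map (fun t => decide (t < p))) :=
    Measure.isProbabilityMeasure_map (measurable_decide_lt p).aemeasurable
  refine Measure.ext_of_singleton fun b => ?_
  rw [Measure.map_apply (measurable_decide_lt p) (measurableSet_singleton _)]
  classical
  rw [bernoulliMeasure_apply _ (measurableSet_singleton _)]
  cases b
  · have : (fun t : I => decide (t < p)) ⁻¹' {false} = Set.Ici p := by ext; simp
    rw [this, unitInterval.volume_Ici]
    simp only [ENNReal.ofReal, Set.mem_singleton_iff, Bool.true_eq_false, if_true, if_false]
    congr 1
    ext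
    simp [p.2.2]
  · have : (fun t : I => decide (t < p)) ⁻¹' {true} = Set.Iio p := by ext; simp
    rw [this, unitInterval.volume_Iio]
    simp only [ENNReal.ofReal, Set.mem_singleton_iff, Bool.false_eq_true, if_true, if_false]
    congr 1
    ext
    simp [p.2.1]

/-- The monotone coupling of two product Bernoulli laws on a finite set, modified so as to live on
a relation `R` that contains the pointwise order. -/
theorem exists_bernoulli_coupling {F : Type*} [Finite F] (a b : F → I)
    (R : (F → Bool) → (F → Bool) → Prop) (hR : ∀ x y, x ≤ y → R x y) (x₀ y₀ : F → Bool)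
    (hx : ∀ y, R x₀ y) (hy : ∀ x, R x y₀) {δ c : ℝ} {K : ℕ} (hδ : 0 ≤ δ) (hc0 : 0 ≤ c)
    (hc1 : c ≤ 1) (hK : Nat.card F ≤ K) (hKc : K * δ ≤ c ^ K)
    (hab : ∀ e, (a e : ℝ) - b e ≤ δ)
    (hc : ∀ e, ENNReal.ofReal c ≤
      volume {t : I | decide (t < a e) = x₀ e ∧ decide (t < b e) = y₀ e}) :
    ∃ π : Measure ((F → Bool) × (F → Bool)), IsProbabilityMeasure π ∧
      π.map Prod.fst = Measure.infinitePi (fun e => bernoulliMeasure true false (a e)) ∧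
      π.map Prod.snd = Measure.infinitePi (fun e => bernoulliMeasure true false (b e)) ∧
      ∀ᵐ z ∂π, R z.1 z.2 := by
  classical
  have := Fintype.ofFinite F
  let m : Measure (F → I) := Measure.infinitePi fun _ => volume
  let T : (F → I) → (F → Bool) × (F → Bool) :=
    fun t => (fun e => decide (t e < a e), fun e => decide (t e < b e))
  have hd : ∀ p : F → I, Measurable fun (t : F → I) e => decide (t e < p e) := fun p =>
    measurable_pi_lambda _ fun e => (measurable_decide_lt (p e)).comp (measurable_pi_apply e)
  have hT : Measurable T := (hd a).prodMk (hd b)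
  have hmarg : ∀ p : F → I, m.map (fun (t : F → I) e => decide (t e < p e)) =
      Measure.infinitePi (fun e => bernoulliMeasure true false (p e)) := fun p => by
    rw [Measure.infinitePi_map_pi (f := fun e t => decide (t < p e)) _
      fun e => measurable_decide_lt (p e)]
    simp_rw [map_decide_lt]
  have : IsProbabilityMeasure (m.map T) := Measure.isProbabilityMeasure_map hT.aemeasurable
  have hbad : m.map T {z | ¬ R z.1 z.2} ≤ ENNReal.ofReal (c ^ K) := by
    rw [Measure.map_apply hT .of_discrete]
    -- The order can fail at `e` only if the uniform variable falls in `[b e, a e)`, an event of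
    -- probability at most `δ`.
    have hsub : T ⁻¹' {z | ¬ R z.1 z.2} ⊆ ⋃ e, (fun t : F → I => t e) ⁻¹' Set.Ico (b e) (a e) := by
      intro t ht
      by_contra hcon
      refine ht (hR _ _ fun e => ?_)
      simp only [Set.mem_iUnion, Set.mem_preimage, Set.mem_Ico, not_exists, not_and] at hcon
      rw [Bool.le_iff_imp]
      intro h1
      have h1 : t e < a e := by simpa [T] using h1
      have := hcon e
      by_contra h2
      have h2 : b e ≤ t e := by simpa [T] using h2
      exact this h2 h1
    calc m (T ⁻¹' {z | ¬ R z.1 z.2})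
        ≤ ∑ e, m ((fun t : F → I => t e) ⁻¹' Set.Ico (b e) (a e)) :=
          (measure_mono hsub).trans (measure_iUnion_fintype_le _ _)
      _ ≤ ∑ _e : F, ENNReal.ofReal δ := by
          refine Finset.sum_le_sum fun e _ => ?_
          rw [(measurePreserving_eval_infinitePi (fun _ : F => (volume : Measure I)) e).measure_preimage
            measurableSet_Ico.nullMeasurableSet, unitInterval.volume_Ico]
          exact ENNReal.ofReal_le_ofReal (hab e)
      _ = ENNReal.ofReal (Fintype.card F * δ) := by
          simp [ENNReal.ofReal_mul]
      _ ≤ ENNReal.ofReal (c ^ K) := by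
          refine ENNReal.ofReal_le_ofReal (le_trans ?_ hKc)
          rw [Nat.card_eq_fintype_card] at hK
          gcongr
  have hgood : ENNReal.ofReal (c ^ K) ≤ m.map T {(x₀, y₀)} := by
    rw [Measure.map_apply hT (measurableSet_singleton _)]
    have hset : T ⁻¹' {(x₀, y₀)} = Set.univ.pi fun e =>
        {t : I | decide (t < a e) = x₀ e ∧ decide (t < b e) = y₀ e} := by
      ext t
      simp only [T, Set.mem_preimage, Set.mem_singleton_iff, Prod.mk.injEq, funext_iff, Set.mem_pi,
        Set.mem_univ, true_imp_iff, Set.mem_ofPred_eq, forall_and]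
    have hme : ∀ e, MeasurableSet {t : I | decide (t < a e) = x₀ e ∧ decide (t < b e) = y₀ e} :=
      fun e => (measurable_decide_lt (a e) (measurableSet_singleton _)).inter
        (measurable_decide_lt (b e) (measurableSet_singleton _))
    rw [hset, Measure.infinitePi_pi_univ _ hme, tprod_fintype]
    calc ENNReal.ofReal (c ^ K) ≤ ENNReal.ofReal (c ^ Fintype.card F) := by
          refine ENNReal.ofReal_le_ofReal (pow_le_pow_of_le_one hc0 hc1 ?_)
          rwa [Nat.card_eq_fintype_card] at hK
      _ = ∏ _e : F, ENNReal.ofReal c := by simp [ENNReal.ofReal_pow hc0]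
      _ ≤ _ := Finset.prod_le_prod' fun e _ => hc e
  obtain ⟨π, hπ, h1, h2, h3⟩ :=
    exists_coupling_of_measure_le (m.map T) R x₀ y₀ hx hy (hbad.trans hgood)
  refine ⟨π, hπ, ?_, ?_, h3⟩
  · rw [h1, Measure.map_map measurable_fst hT, ← hmarg a]; rfl
  · rw [h2, Measure.map_map measurable_snd hT, ← hmarg b]; rfl

/-- The edge set is the disjoint union of the fibres of `label`, so this is associativity of the
product measure, followed by reindexing along `Equiv.sigmaFiberEquiv`. -/
theorem map_infinitePi_glue {E ι : Type*} (label : E → ι) (μ : E → Measure Bool)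
    [∀ e, IsProbabilityMeasure (μ e)] :
    (Measure.infinitePi fun i => Measure.infinitePi fun e : {e // label e = i} => μ e).map
      (fun ω e => ω (label e) ⟨e, rfl⟩) = Measure.infinitePi μ := by
  have h1 := Measure.infinitePi_map_piCurry_symm
    (fun (i : ι) (e : {e // label e = i}) => μ e)
  have h2 := Measure.infinitePi_map_piCongrLeft μ (Equiv.sigmaFiberEquiv label)
  rw [← h2]
  change _ = (Measure.infinitePi fun p : (i : ι) × {e // label e = i} => μ p.2).map _
  rw [← h1, Measure.map_map (by fun_prop) (by fun_prop)]
  congr 1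

/-- Couplings of the restrictions of two product measures to the fibres of `label` combine to a
coupling of the product measures. -/
theorem exists_infinitePi_coupling {E ι : Type*} [Countable ι] (label : E → ι)
    [∀ i, Finite {e // label e = i}] (μ ν : E → Measure Bool) [∀ e, IsProbabilityMeasure (μ e)] [∀ e, IsProbabilityMeasure (ν e)]
    (R : ∀ i, ({e // label e = i} → Bool) → ({e // label e = i} → Bool) → Prop)
    (h : ∀ i, ∃ π : Measure (({e // label e = i} → Bool) × ({e // label e = i} → Bool)),
      IsProbabilityMeasure π ∧ π.map Prod.fst = Measure.infinitePi (fun e : {e // label e = i} => μ e) ∧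
        π.map Prod.snd = Measure.infinitePi (fun e : {e // label e = i} => ν e) ∧ ∀ᵐ z ∂π, R i z.1 z.2) :
    ∃ π : Measure ((E → Bool) × (E → Bool)),
      π.map Prod.fst = Measure.infinitePi μ ∧ π.map Prod.snd = Measure.infinitePi ν ∧
        ∀ᵐ z ∂π, ∀ i, R i (fun e => z.1 e) (fun e => z.2 e) := by
  choose π hπ h1 h2 h3 using h
  let g : ((i : ι) → {e // label e = i} → Bool) → E → Bool := fun ω e => ω (label e) ⟨e, rfl⟩
  have hg : Measurable g := by fun_prop
  let f1 : ((i : ι) → ({e // label e = i} → Bool) × ({e // label e = i} → Bool)) →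
    (i : ι) → {e // label e = i} → Bool := fun ω i => (ω i).1
  let f2 : ((i : ι) → ({e // label e = i} → Bool) × ({e // label e = i} → Bool)) →
    (i : ι) → {e // label e = i} → Bool := fun ω i => (ω i).2
  have hf1 : Measurable f1 := by fun_prop
  have hf2 : Measurable f2 := by fun_prop
  have hF : Measurable fun ω => (g (f1 ω), g (f2 ω)) := (hg.comp hf1).prodMk (hg.comp hf2)
  refine ⟨(Measure.infinitePi π).map fun ω => (g (f1 ω), g (f2 ω)), ?_, ?_, ?_⟩
  · rw [Measure.map_map measurable_fst hF, ← map_infinitePi_glue label μ]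
    simp_rw [← h1]
    rw [← Measure.infinitePi_map_pi π (f := fun _ => Prod.fst) fun _ => measurable_fst,
      Measure.map_map hg (by fun_prop)]
    rfl
  · rw [Measure.map_map measurable_snd hF, ← map_infinitePi_glue label ν]
    simp_rw [← h2]
    rw [← Measure.infinitePi_map_pi π (f := fun _ => Prod.snd) fun _ => measurable_snd,
      Measure.map_map hg (by fun_prop)]
    rfl
  · rw [ae_all_iff]
    intro i
    -- The relation is arbitrary, but it depends on the finitely many coordinates of one fibre only,
    -- hence is measurable.
    have hm : MeasurableSet {z : (E → Bool) × (E → Bool) |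
        R i (fun e => z.1 e) (fun e => z.2 e)} := by
      have hr : Measurable fun z : (E → Bool) × (E → Bool) =>
          ((fun e : {e // label e = i} => z.1 e), (fun e : {e // label e = i} => z.2 e)) := by
        fun_prop
      exact hr (MeasurableSet.of_discrete (s := {z | R i z.1 z.2}))
    rw [ae_map_iff hF.aemeasurable hm]
    have := (measurePreserving_eval_infinitePi π i).quasiMeasurePreserving.ae (h3 i)
    filter_upwards [this] with ω hω
    convert hω using 1 <;>
    · funext ⟨e, he⟩
      subst he
      rfl

-- Open subgraphs and transfer of percolation

universe u

variable {V : Type u}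

/-- The open edges among those that satisfy `P`, as a subgraph of `G × ℤ`. -/
def openPart {G : SimpleGraph V} {P : (ladderGraph G).edgeSet → Prop} (x : {e // P e} → Bool) :
    SimpleGraph (V × ℤ) :=
  SimpleGraph.fromEdgeSet {e | ∃ (h : e ∈ (ladderGraph G).edgeSet) (h' : P ⟨e, h⟩),
    x ⟨⟨e, h⟩, h'⟩ = true}

variable {G : SimpleGraph V}

theorem openPart_adj {P : (ladderGraph G).edgeSet → Prop} {x : {e // P e} → Bool} {a b : V × ℤ} :
    (openPart x).Adj a b ↔
      ∃ (h : (ladderGraph G).Adj a b) (h' : P ⟨s(a, b), h⟩), x ⟨⟨s(a, b), h⟩, h'⟩ = true := by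
  rw [openPart, SimpleGraph.fromEdgeSet_adj]
  constructor
  · rintro ⟨⟨h, h', hx⟩, -⟩
    exact ⟨h, h', hx⟩
  · rintro ⟨h, h', hx⟩
    exact ⟨⟨h, h', hx⟩, h.ne⟩

theorem openGraph_adj {ω : Config G} {a b : V × ℤ} :
    (openGraph ω).Adj a b ↔ ∃ h : (ladderGraph G).Adj a b, ω ⟨s(a, b), h⟩ = true := by
  rw [openGraph, SimpleGraph.fromEdgeSet_adj]
  constructor
  · rintro ⟨⟨h, hx⟩, -⟩
    exact ⟨h, hx⟩
  · rintro ⟨h, hx⟩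
    exact ⟨⟨h, hx⟩, h.ne⟩

theorem openPart_mono {P : (ladderGraph G).edgeSet → Prop} {x y : {e // P e} → Bool}
    (h : x ≤ y) : openPart x ≤ openPart y := by
  intro a b hab
  obtain ⟨h1, h2, h3⟩ := openPart_adj.1 hab
  exact openPart_adj.2 ⟨h1, h2, Bool.le_iff_imp.1 (h _) h3⟩

theorem openPart_restrict_le {P : (ladderGraph G).edgeSet → Prop} (ω : Config G) :
    openPart (fun e : {e // P e} => ω e) ≤ openGraph ω := by
  intro a b hab
  obtain ⟨h1, h2, h3⟩ := openPart_adj.1 hab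
  exact openGraph_adj.2 ⟨h1, h3⟩

theorem exists_mem_edge_of_openPart_reachable {P : (ladderGraph G).edgeSet → Prop}
    {x : {e // P e} → Bool} {a b : V × ℤ} (h : (openPart x).Reachable a b) (hab : a ≠ b) :
    ∃ e, P e ∧ a ∈ (e : Sym2 (V × ℤ)) := by
  obtain ⟨p⟩ := h
  cases p with
  | nil => exact (hab rfl).elim
  | cons h _ =>
    obtain ⟨h1, h2, -⟩ := openPart_adj.1 h
    exact ⟨_, h2, Sym2.mem_mk_left _ _⟩

/-- Every connection between vertices of `T` that is possible in `x` is possible in `y`. -/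
def ConnectsAtMost (T : Set (V × ℤ)) {P : (ladderGraph G).edgeSet → Prop}
    (x y : {e // P e} → Bool) : Prop :=
  ∀ a ∈ T, ∀ b ∈ T, (openPart x).Reachable a b → (openPart y).Reachable a b

section Transfer

variable {ι : Type*} {label : (ladderGraph G).edgeSet → ι} {T : Set (V × ℤ)} {ℓ : V × ℤ → ι}
  {x y : Config G} {a : V × ℤ}

/-- Here `t` is the last vertex of `T` on the path so far. All edges at a vertex outside `T` carry
the same label, so the path stays within one part from `t` until it returns to `T`; there `hR` turns
the excursion into a connection in `y`. -/
theorem exists_reachable_of_connectsAtMost (hℓ : ∀ e : (ladderGraph G).edgeSet,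
      ∀ z ∈ (e : Sym2 (V × ℤ)), z ∉ T → label e = ℓ z)
    (hR : ∀ i, ConnectsAtMost T (fun e : {e // label e = i} => x e)
      (fun e : {e // label e = i} => y e)) (ha : a ∈ T) {z : V × ℤ}
    (hz : (openGraph x).Reachable a z) :
    ∃ t ∈ T, (openGraph y).Reachable a t ∧
      (z = t ∨ z ∉ T ∧ (openPart fun e : {e // label e = ℓ z} => x e).Reachable t z) := by
  rw [SimpleGraph.reachable_iff_reflTransGen] at hz
  induction hz with
  | refl => exact ⟨a, ha, .rfl, .inl rfl⟩
  | @tail z w _ hadj ih =>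
    obtain ⟨t, ht, hyt, htz⟩ := ih
    obtain ⟨hzw, hopen⟩ := openGraph_adj.1 hadj
    have key : ∀ i, label ⟨s(z, w), hzw⟩ = i →
        (openPart fun e : {e // label e = i} => x e).Adj z w := fun i hi =>
      openPart_adj.2 ⟨hzw, hi, hopen⟩
    have hw : w ∉ T → label ⟨s(z, w), hzw⟩ = ℓ w := hℓ _ w (Sym2.mem_mk_right _ _)
    have hreach : (openPart fun e : {e // label e = label ⟨s(z, w), hzw⟩} => x e).Reachable t w := by
      rcases htz with rfl | ⟨hzT, htz⟩
      · exact (key _ rfl).reachable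
      · have hlz := hℓ ⟨s(z, w), hzw⟩ z (Sym2.mem_mk_left _ _) hzT
        rw [← hlz] at htz
        exact htz.trans (key _ rfl).reachable
    by_cases hwT : w ∈ T
    · exact ⟨w, hwT, hyt.trans (((hR _) t ht w hwT hreach).mono (openPart_restrict_le y)), .inl rfl⟩
    · rw [hw hwT] at hreach
      exact ⟨t, ht, hyt, .inr ⟨hwT, hreach⟩⟩

/-- Each vertex of the cluster in `x` lies in the cluster in `y` or in a part touching it. Parts are
finite and the graph is locally finite, so a finite cluster in `y` would force a finite one in `x`.
-/
theorem mem_percolates_of_connectsAtMost (hℓ : ∀ e : (ladderGraph G).edgeSet,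
      ∀ z ∈ (e : Sym2 (V × ℤ)), z ∉ T → label e = ℓ z)
    (hlf : ∀ w : V × ℤ, {e : (ladderGraph G).edgeSet | w ∈ (e : Sym2 (V × ℤ))}.Finite)
    (hfib : ∀ i, {e | label e = i}.Finite)
    (hR : ∀ i, ConnectsAtMost T (fun e : {e // label e = i} => x e)
      (fun e : {e // label e = i} => y e)) (ha : a ∈ T) (hx : x ∈ percolates G a) :
    y ∈ percolates G a := by
  intro hfin
  refine hx (Set.Finite.subset (s := cluster y a ∪ ⋃ t ∈ cluster y a,
    ⋃ e ∈ {e : (ladderGraph G).edgeSet | t ∈ (e : Sym2 (V × ℤ))},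
    ⋃ e' ∈ {e' | label e' = label e}, {z | z ∈ (e' : Sym2 (V × ℤ))}) ?_ ?_)
  · refine hfin.union (hfin.biUnion fun t _ => (hlf t).biUnion fun e _ =>
      (hfib _).biUnion fun e' _ => ?_)
    induction (e' : Sym2 (V × ℤ)) using Sym2.ind with
    | _ p q => exact (Set.toFinite {p, q}).subset fun z hz => by simpa using hz
  · intro z hz
    obtain ⟨t, htT, hyt, rfl | ⟨hzT, htz⟩⟩ := exists_reachable_of_connectsAtMost hℓ hR ha hz
    · exact .inl hyt
    · right
      have hne : t ≠ z := fun h => hzT (h ▸ htT)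
      obtain ⟨e, he, hte⟩ := exists_mem_edge_of_openPart_reachable htz hne
      obtain ⟨e', he', hze⟩ := exists_mem_edge_of_openPart_reachable htz.symm hne.symm
      simp only [Set.mem_iUnion]
      exact ⟨t, hyt, e, hte, e', he'.trans he.symm, hze⟩

end Transfer

/-! ### Measurability and countability -/

theorem measurableSet_percolates [Countable V] (a : V × ℤ) : MeasurableSet (percolates G a) := by
  have hadj : ∀ b c : V × ℤ, MeasurableSet {ω : Config G | (openGraph ω).Adj b c} := by
    intro b c
    by_cases h : (ladderGraph G).Adj b c
    · have : {ω : Config G | (openGraph ω).Adj b c} =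
          (fun ω : Config G => ω ⟨s(b, c), h⟩) ⁻¹' {true} := by
        ext ω; simp [openGraph_adj, h]
      rw [this]
      exact measurable_pi_apply _ (measurableSet_singleton _)
    · have : {ω : Config G | (openGraph ω).Adj b c} = ∅ := by
        ext ω; simp [openGraph_adj, h]
      rw [this]
      exact .empty
  have hwalk : ∀ (n : ℕ) (b c : V × ℤ),
      MeasurableSet {ω : Config G | ∃ p : (openGraph ω).Walk b c, p.length = n} := by
    intro n
    induction n with
    | zero =>
      intro b c
      simp only [SimpleGraph.Walk.exists_length_eq_zero_iff]
      exact .const _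
    | succ n ih =>
      intro b c
      have : {ω : Config G | ∃ p : (openGraph ω).Walk b c, p.length = n + 1} =
          ⋃ d, {ω | (openGraph ω).Adj b d} ∩
            {ω | ∃ p : (openGraph ω).Walk d c, p.length = n} := by
        ext ω
        simp only [Set.mem_ofPred_eq, Set.mem_iUnion, Set.mem_inter_iff]
        constructor
        · rintro ⟨p, hp⟩
          cases p with
          | nil => simp at hp
          | @cons _ d _ h p => exact ⟨d, h, p, by simpa using hp⟩
        · rintro ⟨d, h, p, hp⟩
          exact ⟨.cons h p, by simp [hp]⟩
      rw [this]
      exact .iUnion fun d => (hadj b d).inter (ih d c)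
  have hreach : ∀ b : V × ℤ, MeasurableSet {ω : Config G | b ∈ cluster ω a} := by
    intro b
    have : {ω : Config G | b ∈ cluster ω a} =
        ⋃ n, {ω : Config G | ∃ p : (openGraph ω).Walk a b, p.length = n} := by
      ext ω
      simp only [Set.mem_iUnion, Set.mem_ofPred_eq]
      exact ⟨fun ⟨p⟩ => ⟨_, p, rfl⟩, fun ⟨_, p, _⟩ => ⟨p⟩⟩
    rw [this]
    exact .iUnion fun n => hwalk n a b
  have : percolates G a = ⋂ F : Finset (V × ℤ), ⋃ b ∈ {b : V × ℤ | b ∉ F},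
      {ω : Config G | b ∈ cluster ω a} := by
    ext ω
    simp only [Set.mem_iInter, Set.mem_iUnion, exists_prop]
    constructor
    · intro h F
      obtain ⟨b, hb, hbF⟩ := Set.Infinite.exists_notMem_finset h F
      exact ⟨b, hbF, hb⟩
    · intro h hfin
      obtain ⟨b, hb, hbF⟩ := h hfin.toFinset
      exact hb (hfin.mem_toFinset.2 hbF)
  rw [this]
  exact .iInter fun F => .biUnion (Set.to_countable _) fun b _ => hreach b

theorem countable_of_connected (hconn : G.Connected)
    (hfin : ∀ v, (G.neighborSet v).Finite) : Countable V := by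
  obtain ⟨v⟩ := hconn.nonempty
  have hball : ∀ (n : ℕ) (v : V), {w | ∃ p : G.Walk v w, p.length = n}.Finite := by
    intro n
    induction n with
    | zero =>
      intro v
      exact (Set.finite_singleton v).subset fun w hw =>
        (SimpleGraph.Walk.exists_length_eq_zero_iff.1 hw).symm
    | succ n ih =>
      intro v
      refine ((hfin v).biUnion fun w _ => ih w).subset ?_
      rintro w ⟨p, hp⟩
      cases p with
      | nil => simp at hp
      | @cons _ d _ h p =>
        simp only [Set.mem_iUnion]
        exact ⟨d, h, p, by simpa using hp⟩
  refine Set.countable_univ_iff.1 ((Set.countable_iUnion fun n => (hball n v).countable).mono ?_)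
  intro w _
  obtain ⟨p⟩ := hconn.preconnected v w
  exact Set.mem_iUnion.2 ⟨_, p, rfl⟩

/-! ### Height functions and the comb -/

/-- A connected finite graph on at most `M` vertices has an injective height function with values in
`[1, M * M]` such that every vertex other than the root has a lower neighbour. -/
theorem exists_height {H : G.Subgraph} (hfin : H.verts.Finite) (hconn : H.Connected) {M : ℕ}
    (hM : H.verts.ncard ≤ M) {u₀ : V} (hu₀ : u₀ ∈ H.verts) :
    ∃ h : V → ℤ, Set.InjOn h H.verts ∧ (∀ u ∈ H.verts, 1 ≤ h u ∧ h u ≤ M * M) ∧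
      ∀ u ∈ H.verts, u ≠ u₀ → ∃ u' ∈ H.verts, H.Adj u u' ∧ h u' < h u := by
  classical
  have : Fintype H.verts := hfin.fintype
  have hcard : Fintype.card H.verts ≤ M := by
    rwa [← Nat.card_coe_set_eq, Nat.card_eq_fintype_card] at hM
  have hc : H.coe.Connected := SimpleGraph.Subgraph.connected_iff'.1 hconn
  let d : H.verts → ℕ := fun u => H.coe.dist u ⟨u₀, hu₀⟩
  let i : H.verts → ℕ := fun u => Fintype.equivFin H.verts u
  have hi : ∀ u, i u < M := fun u => (Fintype.equivFin H.verts u).2.trans_le hcard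
  have hd : ∀ u, d u < M := fun u => by
    obtain ⟨p, hp, hl⟩ := hc.exists_path_of_dist u ⟨u₀, hu₀⟩
    have := hp.length_lt
    simp only [d]
    omega
  -- Lexicographic order: first the distance to the root, then an enumeration of the vertices to
  -- break ties. Both entries are below `M`, whence the bound `M * M`.
  let g : H.verts → ℕ := fun u => d u * M + i u + 1
  have hlt : ∀ u v, d u < d v → g u < g v := fun u v huv => by
    have h1 : (d u + 1) * M ≤ d v * M := Nat.mul_le_mul_right _ huv
    have := hi u
    simp only [g]
    linarith [add_mul (d u) 1 M]
  refine ⟨fun v => if hv : v ∈ H.verts then g ⟨v, hv⟩ else 0, ?_, ?_, ?_⟩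
  · intro u hu v hv huv
    simp only [dif_pos hu, dif_pos hv, Nat.cast_inj] at huv
    have hdd : d ⟨u, hu⟩ = d ⟨v, hv⟩ := by
      rcases lt_trichotomy (d ⟨u, hu⟩) (d ⟨v, hv⟩) with h | h | h
      · exact absurd huv (hlt _ _ h).ne
      · exact h
      · exact absurd huv (hlt _ _ h).ne'
    have hii : i ⟨u, hu⟩ = i ⟨v, hv⟩ := by
      simp only [g, hdd] at huv
      omega
    exact congrArg Subtype.val ((Fintype.equivFin H.verts).injective (Fin.ext hii))
  · intro u hu
    simp only [dif_pos hu]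
    have h1 : (d ⟨u, hu⟩ + 1) * M ≤ M * M := Nat.mul_le_mul_right _ (hd _)
    have := hi ⟨u, hu⟩
    constructor
    · exact_mod_cast Nat.le_add_left 1 _
    · have : g ⟨u, hu⟩ ≤ M * M := by
        simp only [g]
        linarith [add_mul (d ⟨u, hu⟩) 1 M]
      exact_mod_cast this
  · intro u hu hne
    obtain ⟨p, hp⟩ := hc.exists_walk_length_eq_dist ⟨u, hu⟩ ⟨u₀, hu₀⟩
    cases p with
    | nil => exact (hne rfl).elim
    | @cons _ w _ hadj p =>
      refine ⟨w, w.2, hadj, ?_⟩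
      simp only [dif_pos hu, dif_pos w.2, Nat.cast_lt]
      refine hlt _ _ ?_
      have := SimpleGraph.dist_le p
      simp only [SimpleGraph.Walk.length_cons] at hp
      change H.coe.dist w ⟨u₀, hu₀⟩ < H.coe.dist ⟨u, hu⟩ ⟨u₀, hu₀⟩
      omega

/-- In an open subgraph whose edges preserve a colour that separates the vertices of `T`, no two
vertices of `T` are connected. -/
theorem connectsAtMost_of_color {T S : Set (V × ℤ)} {P : (ladderGraph G).edgeSet → Prop}
    {x y : {e // P e} → Bool} (color : V × ℤ → ℤ)
    (hadj : ∀ a b, (openPart x).Adj a b → a ∈ S ∧ color a = color b)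
    (hinj : Set.InjOn color (T ∩ S)) : ConnectsAtMost T x y := by
  intro a ha b hb hab
  by_cases hne : a = b
  · exact hne ▸ .rfl
  have hS : ∀ {a b : V × ℤ}, (openPart x).Reachable a b → a ≠ b → a ∈ S := by
    rintro a b ⟨p⟩ hne
    cases p with
    | nil => exact (hne rfl).elim
    | cons h _ => exact (hadj _ _ h).1
  have hcol : color a = color b := by
    obtain ⟨p⟩ := hab
    clear ha hb hne
    induction p with
    | nil => rfl
    | cons h _ ih => exact (hadj _ _ h).2.trans ih
  exact (hne (hinj ⟨ha, hS hab hne⟩ ⟨hb, hS hab.symm (Ne.symm hne)⟩ hcol)).elim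

/-- The comb: in the block of height `L` above level `B` over `H` and its neighbours, all vertices at
the top, at the bottom and over the neighbours are connected as soon as the columns of `H` are open
near the ends, up to the height `h`, the horizontal edges of `H` are open on the levels in between,
and so are all edges at the neighbours. -/
theorem reachable_of_comb {H : G.Subgraph} {Γ : SimpleGraph (V × ℤ)} {h : V → ℤ} {L N B : ℤ}
    {u₀ w₀ : V} {W : Set V} (hN : ∀ u ∈ H.verts, 1 ≤ h u ∧ h u ≤ N) (hL : L = 2 * N + 1)
    (hu₀ : u₀ ∈ H.verts)
    (hpar : ∀ u ∈ H.verts, u ≠ u₀ → ∃ u' ∈ H.verts, H.Adj u u' ∧ h u' < h u)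
    (hbot : ∀ u ∈ H.verts, ∀ j, 0 ≤ j → j + 1 ≤ h u → Γ.Adj (u, B + j) (u, B + j + 1))
    (htop : ∀ u ∈ H.verts, ∀ j, L - h u ≤ j → j + 1 ≤ L → Γ.Adj (u, B + j) (u, B + j + 1))
    (hmid : ∀ u u', H.Adj u u' → ∀ j, h u ≤ j → j ≤ L - h u → h u' ≤ j → j ≤ L - h u' →
      Γ.Adj (u, B + j) (u', B + j))
    (hnbr : ∀ w ∈ W, ∃ u ∈ H.verts, ∀ j, 0 ≤ j → j < L → Γ.Adj (u, B + j) (w, B + j))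
    (hcol : ∀ w ∈ W, ∀ j, 0 ≤ j → j < L → Γ.Adj (w, B + j) (w, B + j + 1))
    (hw₀ : w₀ ∈ W) (hroot : ∀ j, 0 ≤ j → j < L → Γ.Adj (u₀, B + j) (w₀, B + j)) :
    (∀ u ∈ H.verts, Γ.Reachable (w₀, B) (u, B) ∧ Γ.Reachable (w₀, B) (u, B + L)) ∧
      ∀ w ∈ W, ∀ j, 0 ≤ j → j ≤ L → Γ.Reachable (w₀, B) (w, B + j) := by
  have hup : ∀ w ∈ W, ∀ j : ℕ, (j : ℤ) ≤ L → Γ.Reachable (w, B) (w, B + j) := by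
    intro w hw j
    induction j with
    | zero => intro _; simp
    | succ j ih =>
      intro hj
      push_cast at hj ⊢
      rw [← add_assoc]
      exact (ih (by omega)).trans (hcol w hw j (by omega) (by omega)).reachable
  have hup' : ∀ w ∈ W, ∀ j, 0 ≤ j → j ≤ L → Γ.Reachable (w, B) (w, B + j) := by
    intro w hw j h0 hj
    lift j to ℕ using h0
    exact hup w hw j hj
  -- Induction on the height: the lower neighbour `u'` has a wider range `[h u', L - h u']`, so the
  -- level `j` stays admissible all the way down to the root, which is joined to `w₀`.
  have hlev : ∀ (n : ℕ) u, u ∈ H.verts → h u = n → ∀ j, h u ≤ j → j ≤ L - h u →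
      Γ.Reachable (w₀, B) (u, B + j) := by
    intro n
    induction n using Nat.strong_induction_on with
    | _ n ih =>
      intro u hu hn j h1 h2
      have := hN u hu
      by_cases hne : u = u₀
      · subst hne
        exact (hup' w₀ hw₀ j (by omega) (by omega)).trans
          (hroot j (by omega) (by omega)).reachable.symm
      · obtain ⟨u', hu', hadj, hlt⟩ := hpar u hu hne
        have := hN u' hu'
        exact (ih (h u').toNat (by omega) u' hu' (by omega) j (by omega) (by omega)).trans
          (hmid u u' hadj j h1 h2 (by omega) (by omega)).reachable.symm
  have hlev' : ∀ u ∈ H.verts, ∀ j, h u ≤ j → j ≤ L - h u → Γ.Reachable (w₀, B) (u, B + j) :=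
    fun u hu => hlev (h u).toNat u hu (by have := hN u hu; omega)
  refine ⟨fun u hu => ⟨?_, ?_⟩, ?_⟩
  · have := hN u hu
    have key : ∀ j : ℕ, (j : ℤ) ≤ h u → Γ.Reachable (u, B) (u, B + j) := by
      intro j
      induction j with
      | zero => intro _; simp
      | succ j ih =>
        intro hj
        push_cast at hj ⊢
        rw [← add_assoc]
        exact (ih (by omega)).trans (hbot u hu j (by omega) (by omega)).reachable
    have hk := key (h u).toNat (by omega)
    rw [Int.toNat_of_nonneg (by omega)] at hk
    exact (hlev' u hu (h u) le_rfl (by omega)).trans hk.symm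
  · have := hN u hu
    have key : ∀ j : ℕ, L - h u + j ≤ L → Γ.Reachable (u, B + (L - h u)) (u, B + (L - h u + j)) := by
      intro j
      induction j with
      | zero => intro _; simp
      | succ j ih =>
        intro hj
        have := (htop u hu (L - h u + j) (by omega) (by push_cast at hj; omega)).reachable
        have h2 : B + (L - h u + ((j + 1 : ℕ) : ℤ)) = B + (L - h u + j) + 1 := by push_cast; ring
        rw [h2]
        exact (ih (by push_cast at hj; omega)).trans this
    have hk := key (h u).toNat (by omega)
    rw [Int.toNat_of_nonneg (by omega), sub_add_cancel] at hk
    exact (hlev' u hu (L - h u) (by omega) le_rfl).trans hk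
  · intro w hw j h0 hj
    obtain ⟨u, hu, hadj⟩ := hnbr w hw
    have := hN u hu
    -- Level `N` lies in `[h u, L - h u]` for every `u`, since `L = 2 * N + 1`.
    exact ((hlev' u hu N (by omega) (by omega)).trans
      (hadj N (by omega) (by omega)).reachable).trans
      ((hup' w hw N (by omega) (by omega)).symm.trans (hup' w hw j h0 hj))

/-! ### Partition of the edges into blocks -/

section Blocks

variable (H : ℕ → G.Subgraph) (L : ℤ)

/-- The vertices of `H r` and their neighbours. -/
def thickening (r : ℕ) : Set V :=
  {a | ∃ u ∈ (H r).verts, a = u ∨ G.Adj u a}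

/-- The edges of the `k`-th block of height `L` of the thickened cylinder over `H r`. -/
def block (i : ℕ × ℤ) : Set (Sym2 (V × ℤ)) :=
  {e | ∃ (a b : V) (n m : ℤ), e = s((a, n), (b, m)) ∧ a ∈ thickening H i.1 ∧
    b ∈ thickening H i.1 ∧ (a ∈ (H i.1).verts ∨ a = b) ∧ n ≤ m ∧ n / L = i.2}

/-- The vertices that are not in the interior of a block. -/
def blockBoundary : Set (V × ℤ) :=
  {z | ∀ r, z.1 ∈ (H r).verts → L ∣ z.2}

variable {H L}

theorem mem_thickening_of_mem {r : ℕ} {u : V} (hu : u ∈ (H r).verts) : u ∈ thickening H r :=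
  ⟨u, hu, .inl rfl⟩

/-- A common vertex of two thickenings would put their subgraphs at distance at most 2. -/
theorem eq_of_mem_thickening (hconn : G.Connected)
    (hdist : ∀ i j, i ≠ j → ∀ u ∈ (H i).verts, ∀ w ∈ (H j).verts, 3 ≤ G.dist u w) {r s : ℕ} {a : V}
    (hr : a ∈ thickening H r) (hs : a ∈ thickening H s) : r = s := by
  by_contra hne
  have key : ∀ r, a ∈ thickening H r → ∃ u ∈ (H r).verts, G.dist u a ≤ 1 := by
    rintro r ⟨u, hu, rfl | h⟩
    · exact ⟨a, hu, by simp⟩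
    · exact ⟨u, hu, (SimpleGraph.dist_eq_one_iff_adj.2 h).le⟩
  obtain ⟨u, hu, hua⟩ := key r hr
  obtain ⟨w, hw, hwa⟩ := key s hs
  have h1 := hdist r s hne u hu w hw
  have h2 := hconn.dist_triangle (u := u) (v := a) (w := w)
  rw [SimpleGraph.dist_comm (u := a)] at h2
  omega

theorem eq_of_mem_block (hconn : G.Connected)
    (hdist : ∀ i j, i ≠ j → ∀ u ∈ (H i).verts, ∀ w ∈ (H j).verts, 3 ≤ G.dist u w)
    {i j : ℕ × ℤ} {e : Sym2 (V × ℤ)} (hi : e ∈ block H L i) (hj : e ∈ block H L j) : i = j := by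
  obtain ⟨a, b, n, m, rfl, ha, hb, -, hnm, hi⟩ := hi
  obtain ⟨a', b', n', m', he, ha', hb', -, hnm', hj⟩ := hj
  rcases Sym2.eq_iff.1 he with ⟨h1, h2⟩ | ⟨h1, h2⟩ <;>
    simp only [Prod.mk.injEq] at h1 h2 <;> obtain ⟨rfl, rfl⟩ := h1 <;> obtain ⟨rfl, rfl⟩ := h2
  · exact Prod.ext (eq_of_mem_thickening hconn hdist ha ha') (hi.symm.trans hj)
  · obtain rfl : n = m := le_antisymm hnm hnm'
    exact Prod.ext (eq_of_mem_thickening hconn hdist ha hb') (hi.symm.trans hj)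

theorem eq_of_mem_cylinderEdges_of_mem_block (hconn : G.Connected)
    (hdist : ∀ i j, i ≠ j → ∀ u ∈ (H i).verts, ∀ w ∈ (H j).verts, 3 ≤ G.dist u w)
    {i : ℕ × ℤ} {r : ℕ} {e : Sym2 (V × ℤ)} (hi : e ∈ block H L i)
    (hr : e ∈ cylinderEdges (H r)) : r = i.1 := by
  obtain ⟨a, b, n, m, rfl, ha, hb, -, -, -⟩ := hi
  rcases hr with ⟨u, v, k, huv, he⟩ | ⟨w, k, hw, he⟩ <;>
    rcases Sym2.eq_iff.1 he with ⟨h1, h2⟩ | ⟨h1, h2⟩ <;>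
    simp only [Prod.mk.injEq] at h1 h2 <;> obtain ⟨rfl, rfl⟩ := h1 <;> obtain ⟨rfl, rfl⟩ := h2
  · exact eq_of_mem_thickening hconn hdist (mem_thickening_of_mem huv.fst_mem) ha
  · exact eq_of_mem_thickening hconn hdist (mem_thickening_of_mem huv.fst_mem) hb
  · exact eq_of_mem_thickening hconn hdist (mem_thickening_of_mem hw) ha
  · exact eq_of_mem_thickening hconn hdist (mem_thickening_of_mem hw) ha

theorem mem_verts_of_mem_cylinderEdges {H : G.Subgraph} {e : Sym2 (V × ℤ)}
    (he : e ∈ cylinderEdges H) {z : V × ℤ} (hz : z ∈ e) : z.1 ∈ H.verts := by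
  rcases he with ⟨u, v, k, huv, rfl⟩ | ⟨w, k, hw, rfl⟩ <;>
    rcases Sym2.mem_iff.1 hz with rfl | rfl
  · exact huv.fst_mem
  · exact huv.snd_mem
  · exact hw
  · exact hw

theorem exists_mem_block_of_mem_cylinderEdges {r : ℕ} {e : Sym2 (V × ℤ)}
    (he : e ∈ cylinderEdges (H r)) : ∃ i, e ∈ block H L i := by
  rcases he with ⟨u, v, k, huv, rfl⟩ | ⟨w, k, hw, rfl⟩
  · exact ⟨(r, k / L), u, v, k, k, rfl, mem_thickening_of_mem huv.fst_mem,
      mem_thickening_of_mem huv.snd_mem, .inl huv.fst_mem, le_rfl, rfl⟩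
  · exact ⟨(r, k / L), w, w, k, k + 1, rfl, mem_thickening_of_mem hw,
      mem_thickening_of_mem hw, .inr rfl, by omega, rfl⟩

theorem add_one_ediv_of_not_dvd {L m : ℤ} (hL : 0 < L) (h : ¬ L ∣ m + 1) :
    m / L = (m + 1) / L := by
  have h1 := Int.emod_add_mul_ediv (m + 1) L
  have h2 := Int.emod_nonneg (m + 1) hL.ne'
  have h3 := Int.emod_lt_of_pos (m + 1) hL
  have h4 : (m + 1) % L ≠ 0 := fun h0 => h (Int.dvd_of_emod_eq_zero h0)
  exact ((Int.ediv_emod_unique hL (r := (m + 1) % L - 1) (q := (m + 1) / L)).2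
    ⟨by omega, by omega, by omega⟩).1

/-- A vertical edge belongs to the block of its lower end. The edge arriving from below thus lies in
the block of `z` unless the level of `z` is a multiple of `L`. -/
theorem mem_block_of_mem_verts (hL : 0 < L) {e : Sym2 (V × ℤ)} (he : e ∈ (ladderGraph G).edgeSet)
    {z : V × ℤ} (hz : z ∈ e) {r : ℕ} (hr : z.1 ∈ (H r).verts) (hd : ¬ L ∣ z.2) :
    e ∈ block H L (r, z.2 / L) := by
  have hmem := mem_thickening_of_mem hr
  rcases (mem_edgeSet_ladderGraph G e).1 he with ⟨u, v, n, huv, rfl⟩ | ⟨w, n, rfl⟩ <;>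
    rcases Sym2.mem_iff.1 hz with rfl | rfl
  · exact ⟨u, v, n, n, rfl, hmem, ⟨u, hr, .inr huv⟩, .inl hr, le_rfl, rfl⟩
  · exact ⟨v, u, n, n, Sym2.eq_swap, hmem, ⟨v, hr, .inr huv.symm⟩, .inl hr, le_rfl, rfl⟩
  · exact ⟨w, w, n, n + 1, rfl, hmem, hmem, .inr rfl, by omega, rfl⟩
  · exact ⟨w, w, n, n + 1, rfl, hmem, hmem, .inr rfl, by omega,
      add_one_ediv_of_not_dvd hL hd⟩

theorem mem_thickening_of_mem_block (hL : 0 < L) {e : Sym2 (V × ℤ)}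
    (he : e ∈ (ladderGraph G).edgeSet) {i : ℕ × ℤ} (hi : e ∈ block H L i) {z : V × ℤ}
    (hz : z ∈ e) : z.1 ∈ thickening H i.1 ∧ i.2 * L ≤ z.2 ∧ z.2 ≤ i.2 * L + L := by
  obtain ⟨a, b, n, m, rfl, ha, hb, -, hnm, hi⟩ := hi
  have h1 := Int.emod_add_mul_ediv n L
  have h2 := Int.emod_nonneg n hL.ne'
  have h3 := Int.emod_lt_of_pos n hL
  rw [hi, mul_comm] at h1
  have hm : m ≤ n + 1 := by
    rcases (mem_edgeSet_ladderGraph G _).1 he with ⟨u, v, k, -, he⟩ | ⟨w, k, he⟩ <;>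
      rcases Sym2.eq_iff.1 he with ⟨h1, h2⟩ | ⟨h1, h2⟩ <;>
      simp only [Prod.mk.injEq] at h1 h2 <;> omega
  rcases Sym2.mem_iff.1 hz with rfl | rfl
  · exact ⟨ha, by simp only; omega, by simp only; omega⟩
  · exact ⟨hb, by simp only; omega, by simp only; omega⟩

open scoped Classical in
variable (H L) in
/-- The edges are partitioned into the blocks and, outside the blocks, into single edges. -/
noncomputable def blockLabel (e : (ladderGraph G).edgeSet) : (ℕ × ℤ) ⊕ Sym2 (V × ℤ) :=
  if h : ∃ i, (e : Sym2 (V × ℤ)) ∈ block H L i then .inl h.choose else .inr e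

theorem blockLabel_eq_inl (hconn : G.Connected)
    (hdist : ∀ i j, i ≠ j → ∀ u ∈ (H i).verts, ∀ w ∈ (H j).verts, 3 ≤ G.dist u w)
    {e : (ladderGraph G).edgeSet} {i : ℕ × ℤ} :
    blockLabel H L e = .inl i ↔ (e : Sym2 (V × ℤ)) ∈ block H L i := by
  unfold blockLabel
  split_ifs with h
  · rw [Sum.inl.injEq]
    exact ⟨fun hi => hi ▸ h.choose_spec, fun hi => eq_of_mem_block hconn hdist h.choose_spec hi⟩
  · exact ⟨fun hi => by simp at hi, fun hi => (h ⟨i, hi⟩).elim⟩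

theorem blockLabel_eq_inr {e : (ladderGraph G).edgeSet} {e' : Sym2 (V × ℤ)}
    (h : blockLabel H L e = .inr e') :
    (e : Sym2 (V × ℤ)) = e' ∧ ∀ i, (e : Sym2 (V × ℤ)) ∉ block H L i := by
  unfold blockLabel at h
  split_ifs at h with h1
  exact ⟨Sum.inr.inj h, not_exists.1 h1⟩

theorem exists_interior_label (hconn : G.Connected)
    (hdist : ∀ i j, i ≠ j → ∀ u ∈ (H i).verts, ∀ w ∈ (H j).verts, 3 ≤ G.dist u w) (hL : 0 < L) :
    ∃ ℓ : V × ℤ → (ℕ × ℤ) ⊕ Sym2 (V × ℤ), ∀ e : (ladderGraph G).edgeSet,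
      ∀ z ∈ (e : Sym2 (V × ℤ)), z ∉ blockBoundary H L → blockLabel H L e = ℓ z := by
  have : ∀ z : V × ℤ, ∃ i, ∀ e : (ladderGraph G).edgeSet, z ∈ (e : Sym2 (V × ℤ)) →
      z ∉ blockBoundary H L → blockLabel H L e = i := by
    intro z
    by_cases hz : z ∈ blockBoundary H L
    · exact ⟨.inl (0, 0), fun e _ h => (h hz).elim⟩
    · have hz' := hz
      simp only [blockBoundary, Set.mem_ofPred_eq, not_forall] at hz'
      obtain ⟨r, hr, hd⟩ := hz'
      exact ⟨.inl (r, z.2 / L), fun e he _ => (blockLabel_eq_inl hconn hdist).2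
        (mem_block_of_mem_verts hL e.2 he hr hd)⟩
  choose ℓ hℓ using this
  exact ⟨ℓ, fun e z => hℓ z e⟩

/-- A block has at most `M * (D + 1) * (n + 1)` vertices, and its edges are pairs of them. The
summand 1 covers the parts outside the blocks, with at most one edge each. -/
theorem card_blockLabel_fiber_le (hconn : G.Connected)
    (hdist : ∀ i j, i ≠ j → ∀ u ∈ (H i).verts, ∀ w ∈ (H j).verts, 3 ≤ G.dist u w)
    {D M n : ℕ} (hdeg : ∀ v : V, (G.neighborSet v).encard ≤ D) (hfin : ∀ r, (H r).verts.Finite)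
    (hcard : ∀ r, (H r).verts.ncard ≤ M) (hL : 0 < L) (hn : L = n) (i : (ℕ × ℤ) ⊕ Sym2 (V × ℤ)) :
    {e | blockLabel H L e = i}.Finite ∧
      Nat.card {e // blockLabel H L e = i} ≤ (M * (D + 1) * (n + 1)) ^ 2 + 1 := by
  classical
  rcases i with i | e'
  · have hnf : ∀ v, (G.neighborSet v).Finite := fun v =>
      Set.finite_of_encard_le_coe (hdeg v)
    let A : Finset (V × ℤ) := ((hfin i.1).toFinset.biUnion fun u => insert u (hnf u).toFinset) ×ˢ
      Finset.Icc (i.2 * L) (i.2 * L + L)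
    have hA : A.card ≤ M * (D + 1) * (n + 1) := by
      rw [Finset.card_product]
      refine Nat.mul_le_mul ?_ ?_
      · refine (Finset.card_biUnion_le_card_mul _ _ (D + 1) fun u _ => ?_).trans
          (Nat.mul_le_mul_right _ ?_)
        · refine (Finset.card_insert_le _ _).trans (Nat.add_le_add_right ?_ 1)
          have := hdeg u
          rw [(hnf u).encard_eq_coe_toFinset_card] at this
          exact_mod_cast this
        · rw [← Set.ncard_eq_toFinset_card _ (hfin i.1)]
          exact hcard i.1
      · rw [Int.card_Icc]; omega
    let f : {e // blockLabel H L e = .inl i} → Sym2 (V × ℤ) := fun e => e.1.1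
    have hf : Function.Injective f := fun e e' h => Subtype.ext (Subtype.ext h)
    have hsub : Set.range f ⊆ ((A ×ˢ A).image fun z => s(z.1, z.2) : Finset (Sym2 (V × ℤ))) := by
      rintro _ ⟨⟨e, he⟩, rfl⟩
      have hb := (blockLabel_eq_inl hconn hdist).1 he
      have hmem : ∀ z ∈ (e : Sym2 (V × ℤ)), z ∈ A := by
        intro z hz
        obtain ⟨⟨u, hu, h1⟩, h2⟩ := mem_thickening_of_mem_block hL e.2 hb hz
        simp only [A, Finset.mem_product, Finset.mem_biUnion, Set.Finite.mem_toFinset,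
          Finset.mem_insert, Finset.mem_Icc, SimpleGraph.mem_neighborSet]
        exact ⟨⟨u, hu, h1⟩, h2⟩
      obtain ⟨⟨a, b⟩, hab⟩ := Quot.exists_rep (e : Sym2 (V × ℤ))
      have hab : s(a, b) = (e : Sym2 (V × ℤ)) := hab
      rw [Finset.mem_coe, Finset.mem_image]
      refine ⟨(a, b), Finset.mem_product.2 ⟨hmem a ?_, hmem b ?_⟩, hab⟩
      · rw [← hab]; exact Sym2.mem_mk_left _ _
      · rw [← hab]; exact Sym2.mem_mk_right _ _
    have hrange : (Set.range f).Finite := (Finset.finite_toSet _).subset hsub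
    have : Finite (Set.range f) := hrange
    have : Finite {e // blockLabel H L e = .inl i} :=
      Finite.of_injective _ (Set.rangeFactorization_injective.2 hf)
    refine ⟨this, ?_⟩
    rw [← Nat.card_range_of_injective hf, Nat.card_coe_set_eq]
    refine (Set.ncard_le_ncard hsub (Finset.finite_toSet _)).trans ?_
    rw [Set.ncard_coe_finset]
    refine Finset.card_image_le.trans ?_
    rw [Finset.card_product, ← sq]
    exact (Nat.pow_le_pow_left hA 2).trans (Nat.le_succ _)
  · have hss : Subsingleton {e // blockLabel H L e = .inr e'} := ⟨fun e f => Subtype.ext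
      (Subtype.ext ((blockLabel_eq_inr e.2).1.trans (blockLabel_eq_inr f.2).1.symm))⟩
    exact ⟨Finite.of_subsingleton (α := {e // blockLabel H L e = .inr e'}),
      (Finite.card_le_one_iff_subsingleton.2 hss).trans (Nat.le_add_left _ _)⟩

end Blocks

/-! ### The two extreme configurations of a block -/

theorem exists_adj_boundary [Infinite V] (hconn : G.Connected) {S : Set V} (hS : S.Finite)
    (hne : S.Nonempty) : ∃ u ∈ S, ∃ w ∉ S, G.Adj u w := by
  obtain ⟨a, ha⟩ := hne
  obtain ⟨b, hb⟩ := hS.exists_notMem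
  obtain ⟨p⟩ := hconn.preconnected a b
  obtain ⟨d, -, h1, h2⟩ := p.exists_boundary_dart S ha hb
  exact ⟨d.fst, h1, d.snd, h2, d.adj⟩

theorem eq_or_eq_add_of_dvd {L k n : ℤ} (hL : 0 < L) (h : L ∣ n) (h1 : k * L ≤ n)
    (h2 : n ≤ k * L + L) : n = k * L ∨ n = k * L + L := by
  obtain ⟨c, rfl⟩ := h
  have h3 : k ≤ c := by
    refine le_of_mul_le_mul_right (a := L) ?_ hL
    linarith
  have h4 : c ≤ k + 1 := by
    refine le_of_mul_le_mul_right (a := L) ?_ hL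
    linarith
  rcases (by omega : c = k ∨ c = k + 1) with rfl | rfl
  · left; ring
  · right; ring

/-- The height of a vertex above level `B`, clamped to the interval `[h, L - h]`. -/
def combColor (h : V → ℤ) (B L : ℤ) (z : V × ℤ) : ℤ :=
  max (h z.1) (min (z.2 - B) (L - h z.1))

open scoped Classical in
/-- The edges `e` that satisfy `κ e` are open among the edges of the cylinders, and all other edges
are closed. -/
noncomputable def lowConfig (H : ℕ → G.Subgraph) (κ : Sym2 (V × ℤ) → Prop)
    {P : (ladderGraph G).edgeSet → Prop} (e : {e // P e}) : Bool :=
  decide ((e : Sym2 (V × ℤ)) ∈ (⋃ r, cylinderEdges (H r)) ∧ κ e)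

open scoped Classical in
/-- The edges `e` that satisfy `κ e` are open among the edges of the cylinders, and all other edges
are open. -/
noncomputable def highConfig (H : ℕ → G.Subgraph) (κ : Sym2 (V × ℤ) → Prop)
    {P : (ladderGraph G).edgeSet → Prop} (e : {e // P e}) : Bool :=
  decide ((e : Sym2 (V × ℤ)) ∈ (⋃ r, cylinderEdges (H r)) → κ e)

theorem lowConfig_eq_true_iff {H : ℕ → G.Subgraph} {κ : Sym2 (V × ℤ) → Prop}
    {P : (ladderGraph G).edgeSet → Prop} {e : {e // P e}} : lowConfig H κ e = true ↔
      (e : Sym2 (V × ℤ)) ∈ (⋃ r, cylinderEdges (H r)) ∧ κ e := by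
  simp only [lowConfig, decide_eq_true_eq]

theorem highConfig_eq_true_iff {H : ℕ → G.Subgraph} {κ : Sym2 (V × ℤ) → Prop}
    {P : (ladderGraph G).edgeSet → Prop} {e : {e // P e}} : highConfig H κ e = true ↔
      ((e : Sym2 (V × ℤ)) ∈ (⋃ r, cylinderEdges (H r)) → κ e) := by
  simp only [highConfig, decide_eq_true_eq]

theorem finite_edges_at (hnf : ∀ v, (G.neighborSet v).Finite) (w : V × ℤ) :
    {e : (ladderGraph G).edgeSet | w ∈ (e : Sym2 (V × ℤ))}.Finite := by
  have hfin : ((fun z => s(w, z)) '' (insert w.1 (G.neighborSet w.1) ×ˢ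
      Set.Icc (w.2 - 1) (w.2 + 1))).Finite :=
    (((hnf w.1).insert _).prod (Set.finite_Icc _ _)).image _
  refine (hfin.preimage Subtype.val_injective.injOn).subset fun e he => ?_
  rcases (mem_edgeSet_ladderGraph G e).1 e.2 with ⟨u, v, n, huv, h⟩ | ⟨u, n, h⟩ <;>
    rw [Set.mem_ofPred_eq, h, Sym2.mem_iff] at he <;> rcases he with rfl | rfl <;>
    rw [Set.mem_preimage, h]
  · exact ⟨(v, n), ⟨.inr huv, by simp⟩, rfl⟩
  · exact ⟨(u, n), ⟨.inr huv.symm, by simp⟩, Sym2.eq_swap⟩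
  · exact ⟨(u, n + 1), ⟨.inl rfl, by simp; omega⟩, rfl⟩
  · exact ⟨(u, n), ⟨.inl rfl, by simp; omega⟩, Sym2.eq_swap⟩

/-- Open edges lie in the cylinder and preserve `combColor`. At the bottom end of the column of `u`
the colour is `h u`, in `[1, N]`; at the top end it is `L - h u`, in `[N + 1, 2 * N]`. As `h` is
injective, the ends have distinct colours. -/
theorem lowConfig_connectsAtMost {H : ℕ → G.Subgraph} {L : ℤ} (hconn : G.Connected)
    (hdist : ∀ i j, i ≠ j → ∀ u ∈ (H i).verts, ∀ w ∈ (H j).verts, 3 ≤ G.dist u w)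
    {N : ℤ} (hL : L = 2 * N + 1) (hL0 : 0 < L) (i : ℕ × ℤ) {h : V → ℤ} (hinj : Set.InjOn h (H i.1).verts)
    (hN : ∀ u ∈ (H i.1).verts, 1 ≤ h u ∧ h u ≤ N)
    (y : {e : (ladderGraph G).edgeSet // blockLabel H L e = .inl i} → Bool) :
    ConnectsAtMost (blockBoundary H L) (lowConfig H fun e => ∀ z ∈ e, ∀ z' ∈ e,
      combColor h (i.2 * L) L z = combColor h (i.2 * L) L z') y := by
  refine connectsAtMost_of_color (S := {z | z.1 ∈ (H i.1).verts ∧ i.2 * L ≤ z.2 ∧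
    z.2 ≤ i.2 * L + L}) (combColor h (i.2 * L) L) ?_ ?_
  · intro a b hab
    obtain ⟨hadj, hP, hx⟩ := openPart_adj.1 hab
    obtain ⟨hin, hκ⟩ := lowConfig_eq_true_iff.1 hx
    obtain ⟨r, hr⟩ := Set.mem_iUnion.1 hin
    have hb := (blockLabel_eq_inl hconn hdist).1 hP
    obtain rfl := eq_of_mem_cylinderEdges_of_mem_block hconn hdist hb hr
    exact ⟨⟨mem_verts_of_mem_cylinderEdges hr (Sym2.mem_mk_left _ _),
      (mem_thickening_of_mem_block hL0 hadj hb (Sym2.mem_mk_left _ _)).2⟩,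
      hκ _ (Sym2.mem_mk_left _ _) _ (Sym2.mem_mk_right _ _)⟩
  · rintro ⟨a, n⟩ ⟨haT, ha, ha1, ha2⟩ ⟨b, m⟩ ⟨hbT, hb, hb1, hb2⟩ hab
    have hn := eq_or_eq_add_of_dvd hL0 (haT _ ha) ha1 ha2
    have hm := eq_or_eq_add_of_dvd hL0 (hbT _ hb) hb1 hb2
    have := hN a ha
    have := hN b hb
    simp only [combColor] at hab hn hm
    have hh : h a = h b ∧ n = m := by omega
    exact Prod.ext (hinj ha hb hh.1) hh.2

/-- The cylinder edges that preserve `combColor` include the teeth and rungs of the comb, and the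
columns over the outer neighbours are fully open. Hence every boundary vertex of the block is
connected to the hub `(w₀, i.2 * L)`. -/
theorem connectsAtMost_highConfig {H : ℕ → G.Subgraph} {L : ℤ} (hconn : G.Connected)
    (hdist : ∀ i j, i ≠ j → ∀ u ∈ (H i).verts, ∀ w ∈ (H j).verts, 3 ≤ G.dist u w)
    {N : ℤ} (hL : L = 2 * N + 1) (hL0 : 0 < L) (i : ℕ × ℤ) {h : V → ℤ}
    (hN : ∀ u ∈ (H i.1).verts, 1 ≤ h u ∧ h u ≤ N) {u₀ w₀ : V} (hu₀ : u₀ ∈ (H i.1).verts)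
    (hw₀ : w₀ ∉ (H i.1).verts) (hadj₀ : G.Adj u₀ w₀)
    (hpar : ∀ u ∈ (H i.1).verts, u ≠ u₀ → ∃ u' ∈ (H i.1).verts, (H i.1).Adj u u' ∧ h u' < h u)
    (x : {e : (ladderGraph G).edgeSet // blockLabel H L e = .inl i} → Bool) :
    ConnectsAtMost (blockBoundary H L) x (highConfig H fun e => ∀ z ∈ e, ∀ z' ∈ e,
      combColor h (i.2 * L) L z = combColor h (i.2 * L) L z') := by
  set κ : Sym2 (V × ℤ) → Prop := fun e => ∀ z ∈ e, ∀ z' ∈ e,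
      combColor h (i.2 * L) L z = combColor h (i.2 * L) L z' with hκdef
  set Γ := openPart (highConfig H κ :
    {e : (ladderGraph G).edgeSet // blockLabel H L e = .inl i} → Bool) with hΓ
  have hκ : ∀ a b : V × ℤ, combColor h (i.2 * L) L a = combColor h (i.2 * L) L b → κ s(a, b) := by
    intro a b hab z hz z' hz'
    rcases Sym2.mem_iff.1 hz with rfl | rfl <;> rcases Sym2.mem_iff.1 hz' with rfl | rfl <;>
      simp [hab]
  have hdiv : ∀ j, 0 ≤ j → j < L → (i.2 * L + j) / L = i.2 := fun j h0 h1 =>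
    ((Int.ediv_emod_unique hL0 (r := j)).2 ⟨by ring, h0, h1⟩).1
  have hvert : ∀ w ∈ thickening H i.1, ∀ j, 0 ≤ j → j < L →
      (w ∈ (H i.1).verts → combColor h (i.2 * L) L (w, i.2 * L + j) =
        combColor h (i.2 * L) L (w, i.2 * L + j + 1)) →
      Γ.Adj (w, i.2 * L + j) (w, i.2 * L + j + 1) := by
    intro w hw j h0 h1 hcol
    have hb : s((w, i.2 * L + j), (w, i.2 * L + j + 1)) ∈ block H L i :=
      ⟨w, w, _, _, rfl, hw, hw, .inr rfl, by omega, hdiv j h0 h1⟩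
    refine openPart_adj.2 ⟨(mem_edgeSet_ladderGraph G _).2 (.inr ⟨w, _, rfl⟩),
      (blockLabel_eq_inl hconn hdist).2 hb, highConfig_eq_true_iff.2 fun hin => hκ _ _ ?_⟩
    obtain ⟨r, hr⟩ := Set.mem_iUnion.1 hin
    obtain rfl := eq_of_mem_cylinderEdges_of_mem_block hconn hdist hb hr
    exact hcol (mem_verts_of_mem_cylinderEdges hr (Sym2.mem_mk_left _ _))
  have hhor : ∀ u ∈ (H i.1).verts, ∀ w, G.Adj u w → ∀ j, 0 ≤ j → j < L →
      (w ∈ (H i.1).verts → combColor h (i.2 * L) L (u, i.2 * L + j) =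
        combColor h (i.2 * L) L (w, i.2 * L + j)) →
      Γ.Adj (u, i.2 * L + j) (w, i.2 * L + j) := by
    intro u hu w huw j h0 h1 hcol
    have hb : s((u, i.2 * L + j), (w, i.2 * L + j)) ∈ block H L i :=
      ⟨u, w, _, _, rfl, mem_thickening_of_mem hu, ⟨u, hu, .inr huw⟩, .inl hu, le_rfl,
        hdiv j h0 h1⟩
    refine openPart_adj.2 ⟨(mem_edgeSet_ladderGraph G _).2 (.inl ⟨u, w, _, huw, rfl⟩),
      (blockLabel_eq_inl hconn hdist).2 hb, highConfig_eq_true_iff.2 fun hin => hκ _ _ ?_⟩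
    obtain ⟨r, hr⟩ := Set.mem_iUnion.1 hin
    obtain rfl := eq_of_mem_cylinderEdges_of_mem_block hconn hdist hb hr
    exact hcol (mem_verts_of_mem_cylinderEdges hr (Sym2.mem_mk_right _ _))
  obtain ⟨hends, hsides⟩ := reachable_of_comb (Γ := Γ) (B := i.2 * L)
    (W := thickening H i.1 \ (H i.1).verts) hN hL hu₀ hpar
    (fun u hu j h0 h1 => hvert u (mem_thickening_of_mem hu) j h0 (by have := hN u hu; omega)
      fun _ => by have := hN u hu; simp only [combColor]; omega)
    (fun u hu j h0 h1 => hvert u (mem_thickening_of_mem hu) j (by have := hN u hu; omega) (by omega)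
      fun _ => by have := hN u hu; simp only [combColor]; omega)
    (fun u u' huu' j h1 h2 h3 h4 => hhor u huu'.fst_mem u' huu'.adj_sub j
      (by have := hN u huu'.fst_mem; omega) (by have := hN u huu'.fst_mem; omega)
      fun _ => by simp only [combColor]; omega)
    (by
      rintro w ⟨⟨u, hu, rfl | huw⟩, hw⟩
      · exact (hw hu).elim
      · exact ⟨u, hu, fun j h0 h1 => hhor u hu w huw j h0 h1 fun h => (hw h).elim⟩)
    (fun w hw j h0 h1 => hvert w hw.1 j h0 h1 fun h => (hw.2 h).elim)
    (w₀ := w₀) ⟨⟨u₀, hu₀, .inr hadj₀⟩, hw₀⟩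
    (fun j h0 h1 => hhor u₀ hu₀ w₀ hadj₀ j h0 h1 fun h => (hw₀ h).elim)
  have hub : ∀ a ∈ blockBoundary H L, ∀ e : (ladderGraph G).edgeSet, blockLabel H L e = .inl i →
      a ∈ (e : Sym2 (V × ℤ)) → Γ.Reachable (w₀, i.2 * L) a := by
    rintro ⟨a, n⟩ haT e he hae
    obtain ⟨h1, h2, h3⟩ :=
      mem_thickening_of_mem_block hL0 e.2 ((blockLabel_eq_inl hconn hdist).1 he) hae
    by_cases ha : a ∈ (H i.1).verts
    · rcases eq_or_eq_add_of_dvd hL0 (haT _ ha) h2 h3 with h | h <;> simp only at h <;> subst h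
      · exact (hends a ha).1
      · exact (hends a ha).2
    · have := hsides a ⟨h1, ha⟩ (n - i.2 * L) (by simp only at h2; omega) (by simp only at h3; omega)
      rwa [add_sub_cancel] at this
  intro a ha b hb hab
  by_cases hne : a = b
  · exact hne ▸ .rfl
  obtain ⟨e, he, hae⟩ := exists_mem_edge_of_openPart_reachable hab hne
  obtain ⟨e', he', hbe⟩ := exists_mem_edge_of_openPart_reachable hab.symm (Ne.symm hne)
  exact (hub a ha e he hae).symm.trans (hub b hb e' he' hbe)

/-- In every part of the partition there are a configuration that connects no vertices of the
boundary and one that connects all of them, which agree on the edges of the cylinders. -/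
theorem exists_extreme_configs [Infinite V] {H : ℕ → G.Subgraph} {L : ℤ} (hconn : G.Connected)
    (hfin : ∀ r, (H r).verts.Finite) (hHconn : ∀ r, (H r).Connected)
    (hdist : ∀ i j, i ≠ j → ∀ u ∈ (H i).verts, ∀ w ∈ (H j).verts, 3 ≤ G.dist u w)
    {M : ℕ} (hcard : ∀ r, (H r).verts.ncard ≤ M) (hL : L = 2 * (M * M) + 1)
    (i : (ℕ × ℤ) ⊕ Sym2 (V × ℤ)) :
    ∃ κ : Sym2 (V × ℤ) → Prop,
      (∀ y : {e : (ladderGraph G).edgeSet // blockLabel H L e = i} → Bool,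
        ConnectsAtMost (blockBoundary H L) (lowConfig H κ) y) ∧
      ∀ x : {e : (ladderGraph G).edgeSet // blockLabel H L e = i} → Bool,
        ConnectsAtMost (blockBoundary H L) x (highConfig H κ) := by
  have hL0 : 0 < L := by rw [hL]; positivity
  rcases i with i | e₀
  · obtain ⟨u₀, hu₀, w₀, hw₀, hadj₀⟩ := exists_adj_boundary hconn (hfin i.1)
      (SimpleGraph.Subgraph.connected_iff.1 (hHconn i.1)).2
    obtain ⟨h, hinj, hN, hpar⟩ := exists_height (hfin i.1) (hHconn i.1) (hcard i.1) hu₀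
    exact ⟨_, lowConfig_connectsAtMost hconn hdist hL hL0 i hinj hN,
      connectsAtMost_highConfig hconn hdist hL hL0 i hN hu₀ hw₀ hadj₀ hpar⟩
  · have hout : ∀ e : {e : (ladderGraph G).edgeSet // blockLabel H L e = .inr e₀},
        (e : Sym2 (V × ℤ)) ∉ ⋃ r, cylinderEdges (H r) := by
      intro e he
      obtain ⟨r, hr⟩ := Set.mem_iUnion.1 he
      obtain ⟨i, hi⟩ := exists_mem_block_of_mem_cylinderEdges (L := L) hr
      exact (blockLabel_eq_inr e.2).2 i hi
    -- Such a part contains no cylinder edge, so the two configurations are all closed and all open,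
    -- whatever the predicate.
    refine ⟨fun _ => False, fun y a _ b _ hab => ?_, fun x a _ b _ hab => hab.mono ?_⟩
    · by_cases hne : a = b
      · exact hne ▸ .rfl
      · obtain ⟨p⟩ := hab
        cases p with
        | nil => exact .rfl
        | cons h _ =>
          obtain ⟨_, _, hx⟩ := openPart_adj.1 h
          exact (lowConfig_eq_true_iff.1 hx).2.elim
    · refine openPart_mono fun e => ?_
      rw [Bool.le_iff_imp]
      exact fun _ => highConfig_eq_true_iff.2 fun he => (hout e he).elim

/-! ### Comparison of the measures and continuity -/

/-- Raising `p` makes up for a small change of `q`. -/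
theorem exists_percolates_null_transfer [Infinite V] (hconn : G.Connected) {D M : ℕ}
    (hdeg : ∀ v : V, (G.neighborSet v).encard ≤ D) (H : ℕ → G.Subgraph)
    (hfin : ∀ r, (H r).verts.Finite) (hHconn : ∀ r, (H r).Connected)
    (hdist : ∀ i j, i ≠ j → ∀ u ∈ (H i).verts, ∀ w ∈ (H j).verts, 3 ≤ G.dist u w)
    (hcard : ∀ r, (H r).verts.ncard ≤ M) :
    ∃ K : ℕ, ∀ (p p' q q' : I) (c : ℝ), 0 ≤ c → c ≤ p' - p → c ≤ q → c ≤ q' → c ≤ 1 - q →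
      c ≤ 1 - q' → K * |(q : ℝ) - q'| ≤ c ^ K → ∀ v : V,
      percolationMeasure H q' p' (percolates G (v, 0)) = 0 →
      percolationMeasure H q p (percolates G (v, 0)) = 0 := by
  classical
  let n : ℕ := 2 * (M * M) + 1
  let L : ℤ := n
  have hL : L = 2 * (M * M) + 1 := by simp [L, n]
  have hL0 : 0 < L := by rw [hL]; positivity
  have hnf : ∀ v, (G.neighborSet v).Finite := fun v => Set.finite_of_encard_le_coe (hdeg v)
  have : Countable V := countable_of_connected hconn hnf
  have : Countable (Sym2 (V × ℤ)) := inferInstanceAs (Countable (Quot _))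
  -- The same `K` bounds the number of edges in every part; it serves as factor in the union bound
  -- and as exponent of `c`.
  refine ⟨(M * (D + 1) * (n + 1)) ^ 2 + 1, ?_⟩
  intro p p' q q' c hc0 hp hq hq' hq1 hq1' hK v hnull
  have hfib := card_blockLabel_fiber_le hconn hdist hdeg hfin hcard hL0 (rfl : L = n)
  have hfibfin : ∀ i, Finite {e // blockLabel H L e = i} := fun i => (hfib i).1
  obtain ⟨ℓ, hℓ⟩ := exists_interior_label hconn hdist hL0
  obtain ⟨π, h1, h2, h3⟩ := exists_infinitePi_coupling (blockLabel H L)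
    (fun e => bernoulliMeasure true false (edgeProb H q p e))
    (fun e => bernoulliMeasure true false (edgeProb H q' p' e))
    (fun i x y => ConnectsAtMost (blockBoundary H L) x y) (by
      intro i
      obtain ⟨κ, hlow, hhigh⟩ := exists_extreme_configs hconn hfin hHconn hdist hcard hL i
      refine exists_bernoulli_coupling
        (fun e : {e // blockLabel H L e = i} => edgeProb H q p e)
        (fun e : {e // blockLabel H L e = i} => edgeProb H q' p' e)
        _ (fun x y hxy a _ b _ hab => hab.mono (openPart_mono hxy)) (lowConfig H κ)
        (highConfig H κ) hlow hhigh (abs_nonneg ((q : ℝ) - q')) hc0 (by linarith [q.2.2])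
        (hfib i).2 hK ?_ ?_
      · intro e
        unfold edgeProb
        split_ifs
        · exact le_abs_self _
        · exact le_trans (by linarith) (abs_nonneg _)
      · intro e
        by_cases hin : (e : Sym2 (V × ℤ)) ∈ ⋃ r, cylinderEdges (H r)
        · simp only [edgeProb, lowConfig, highConfig, hin, if_true, true_and, true_imp_iff]
          by_cases hκ : κ e
          · have : {t : I | decide (t < q) = decide (κ e) ∧ decide (t < q') = decide (κ e)} =
                Set.Iio (min q q') := by
              ext t; simp [hκ]
            rw [this, unitInterval.volume_Iio]
            refine ENNReal.ofReal_le_ofReal ?_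
            rcases min_choice q q' with h | h <;> rw [h] <;> assumption
          · have : {t : I | decide (t < q) = decide (κ e) ∧ decide (t < q') = decide (κ e)} =
                Set.Ici (max q q') := by
              ext t; simp [hκ]
            rw [this, unitInterval.volume_Ici]
            refine ENNReal.ofReal_le_ofReal ?_
            rcases max_choice q q' with h | h <;> rw [h] <;> assumption
        · simp only [edgeProb, lowConfig, highConfig, hin, if_false, false_and, false_imp_iff]
          have : {t : I | decide (t < p) = decide False ∧ decide (t < p') = decide True} =
              Set.Ico p p' := by
            ext t; simp
          rw [this, unitInterval.volume_Ico]
          exact ENNReal.ofReal_le_ofReal hp)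
  have hmeas := measurableSet_percolates (G := G) (v, 0)
  unfold percolationMeasure at hnull ⊢
  rw [← h2, Measure.map_apply measurable_snd hmeas] at hnull
  rw [← h1, Measure.map_apply measurable_fst hmeas]
  refine measure_mono_null_ae ?_ hnull
  filter_upwards [h3] with z hz hz1
  -- The starting vertex `(v, 0)` is a boundary vertex because `L ∣ 0`.
  exact mem_percolates_of_connectsAtMost hℓ (finite_edges_at hnf) (fun i => (hfib i).1) hz
    (by intro r _; exact dvd_zero _) hz1

end LadderPercolation

theorem theorem1 {V : Type*} [Infinite V] (G : SimpleGraph V) (hconn : G.Connected)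
    (hdeg : ∃ D : ℕ, ∀ v : V, (G.neighborSet v).encard ≤ D)
    (H : ℕ → G.Subgraph)
    (hHfin : ∀ r, (H r).verts.Finite)
    (hHconn : ∀ r, (H r).Connected)
    (hHdist : ∀ i j, i ≠ j → ∀ u ∈ (H i).verts, ∀ w ∈ (H j).verts, 3 ≤ G.dist u w)
    (hHcard : BddAbove (Set.range fun r => (H r).verts.ncard))
    (v : V) :
    ContinuousOn (LadderPercolation.criticalCurve H v) (Set.Ioo 0 1) := by
  obtain ⟨D, hD⟩ := hdeg
  obtain ⟨M, hM⟩ := hHcard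
  obtain ⟨K, hK⟩ := LadderPercolation.exists_percolates_null_transfer hconn hD H hHfin hHconn hHdist
    (M := M) fun r => hM ⟨r, rfl⟩
  have hnonneg : ∀ q, 0 ≤ LadderPercolation.criticalCurve H v q := fun q =>
    Real.sSup_nonneg (by rintro _ ⟨p, rfl, -⟩; exact p.2.1)
  have hstep : ∀ (q q' : I) (ε c : ℝ), 0 ≤ c → c ≤ ε → c ≤ q → c ≤ q' → c ≤ 1 - q → c ≤ 1 - q' →
      K * |(q : ℝ) - q'| ≤ c ^ K →
      LadderPercolation.criticalCurve H v q' ≤ LadderPercolation.criticalCurve H v q + ε := by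
    intro q q' ε c hc0 hc hq hq' hq1 hq1' hKc
    have h0 := hnonneg q
    refine Real.sSup_le ?_ (by linarith)
    rintro _ ⟨p', rfl, hp'⟩
    -- If `p' < ε`, nonnegativity of the critical value suffices; otherwise `p' - ε` is an
    -- admissible parameter, and there is no percolation at `(q, p' - ε)`.
    by_cases hlt : (p' : ℝ) < ε
    · linarith
    · let p : I := ⟨p' - ε, by linarith, by linarith [p'.2.2]⟩
      have hp := hK p p' q q' c hc0 (by simp only [p]; linarith) hq hq' hq1 hq1' hKc v hp'
      have : (p : ℝ) ≤ LadderPercolation.criticalCurve H v q :=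
        le_csSup ⟨1, by rintro _ ⟨p, rfl, -⟩; exact p.2.2⟩ ⟨p, rfl, hp⟩
      simp only [p] at this
      linarith
  intro q₀ hq₀
  refine ContinuousAt.continuousWithinAt ?_
  rw [Metric.continuousAt_iff]
  intro ε hε
  have hpos : (0 : ℝ) < q₀ := hq₀.1
  have hlt1 : (q₀ : ℝ) < 1 := hq₀.2
  -- The halves leave room for `q`: if `|q - q₀| < c`, then `q` also lies in `[c, 1 - c]`.
  let c : ℝ := min (ε / 2) (min (q₀ / 2) ((1 - q₀) / 2))
  have hc : 0 < c := by
    refine lt_min (by linarith) (lt_min (by linarith) (by linarith))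
  have hc1 : c ≤ ε / 2 := min_le_left _ _
  have hc2 : c ≤ q₀ / 2 := (min_le_right _ _).trans (min_le_left _ _)
  have hc3 : c ≤ (1 - q₀) / 2 := (min_le_right _ _).trans (min_le_right _ _)
  -- Dividing by `K + 1` avoids a zero denominator.
  refine ⟨min c (c ^ K / (K + 1)), lt_min hc (by positivity), fun q hq => ?_⟩
  rw [Subtype.dist_eq, Real.dist_eq, lt_min_iff] at hq
  obtain ⟨h1, h2⟩ := abs_lt.1 hq.1
  have hKc : K * |(q : ℝ) - q₀| ≤ c ^ K := by
    have := (lt_div_iff₀ (by positivity)).1 hq.2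
    linarith [abs_nonneg ((q : ℝ) - q₀)]
  have hKc' : K * |(q₀ : ℝ) - q| ≤ c ^ K := by rwa [abs_sub_comm]
  have h3 := hstep q q₀ (ε / 2) c hc.le hc1 (by linarith) (by linarith) (by linarith) (by linarith)
    hKc
  have h4 := hstep q₀ q (ε / 2) c hc.le hc1 (by linarith) (by linarith) (by linarith) (by linarith)
    hKc'
  rw [Real.dist_eq, abs_lt]
  constructor <;> linarith
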